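/- **Model.** Let $\gamma\ge 0$ and $\nu\in(0,1)$, and for $n>0$ (the average number of nodes) put $L=n^{\gamma}$, $m=n^{\nu}$, $q=n^{1-\nu}$, $d_c=L/\sqrt m$. Let $\mathcal O$ be the square of edge $L$ with wrap-around at the edges (a flat torus), and let $\|\xi-\zeta\|$ be the Euclidean distance on it. Let $s:[0,\infty)\to[0,\infty)$ be continuous, non-increasing, not identically zero, with $\int_0^\infty \rho\,s(\rho)\,d\rho<\infty$, and put $$k(c,\xi)=\frac{s(\|\xi-c\|)}{\int_{\mathcal O}s(\|\zeta-c\|)\,d\zeta}.$$ The shot-noise Cox process (SNCP) is given by cluster centres $c_1,\dots,c_M$ that form a homogeneous Poisson process on $\mathcal O$ with intensity $m/L^2$ (so $E[M]=m$), and nodes $\mathbf X=\{X_1,\dots,X_N\}$ that, given the centres, form a Poisson process on $\mathcal O$ with intensity function $$\Phi(\xi)=\sum_{j=1}^{M}q\,k(c_j,\xi).$$ "W.h.p." means with probability $1-O(1/n)$ as $n\to\infty$. For a constant $g>0$ put $\underline\Phi_0(n)=g\,n/L^2$ in the cluster-dense case $\gamma<\nu/2$, and $\underline\Phi_0(n)=g\,q\,\log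 m\; s(d_c\sqrt{\log m})$ in the cluster-sparse case $\gamma>\nu/2$. Call $g$ *admissible* if w.h.p. $\Phi(\xi)>\underline\Phi_0(n)$ for all $\xi\in\mathcal O$. **Statement.** (a) Admissible constants exist: there is an admissible $g=g_1>0$ in the cluster-dense case, and there is an admissible $g=g_2>0$ in the cluster-sparse case if $s$ has a power-law tail, i.e. $s(\rho)=\Theta(\rho^{-\delta})$ as $\rho\to\infty$ for some $\delta>2$ (for instance $s(\rho)=\min(1,\rho^{-\delta})$). (b) In both cases, for every admissible $g>0$ one can w.h.p. extract from a realization of the SNCP a subset $\mathbf Z\subseteq\mathbf X$ of nodes that forms a homogeneous Poisson process on $\mathcal O$ with intensity $\underline\Phi_0(n)$. That is, there is a measurable choice of $\mathbf Z\subseteq\mathbf X$, depending on the realization and on a source of randomness independent of it, and there is an event $G$ for the centres, of probability $1-O(1/n)$, such that for all centre configurations in $G$ the conditional law of $\mathbf Z$ given the centres is that of a homogeneous Poisson process on $\mathcal O$ with intensity $\underline\Phi_0(n)$. -/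

import Mathlib

open MeasureTheory ProbabilityTheory Filter Set Asymptotics
open scoped ENNReal

universe u v

noncomputable section

namespace SNCP

/-! ### Point processes -/

open Classical in
/-- The number of points of the finite family `(x i)`, `i ∈ S`, that lie in `A`. -/
def countIn (S : Finset ℕ) (x : ℕ → ℝ × ℝ) (A : Set (ℝ × ℝ)) : ℕ :=
  (S.filter (fun i => x i ∈ A)).card

/-- On the space `(Ω, P)`, the random finite point set `{x i : i ∈ S}` in the plane is a Poisson
point process with (finite) intensity measure `μ`: for pairwise disjoint measurable sets
`A 0, …, A (k - 1)`, the numbers of points in them are independent Poisson variables with means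
`μ (A 0), …, μ (A (k - 1))`. -/
structure IsPoissonProcess {Ω : Type u} [MeasurableSpace Ω] (P : Measure Ω)
    (S : Ω → Finset ℕ) (x : ℕ → Ω → ℝ × ℝ) (μ : Measure (ℝ × ℝ)) : Prop where
  measurableSet_mem : ∀ i, MeasurableSet {ω | i ∈ S ω}
  measurable_point : ∀ i, Measurable (x i)
  finite_intensity : μ Set.univ < ⊤
  map_countIn : ∀ (k : ℕ) (A : Fin k → Set (ℝ × ℝ)), (∀ a, MeasurableSet (A a)) →
    Pairwise (fun a b => Disjoint (A a) (A b)) →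
    P.map (fun ω a => countIn (S ω) (fun i => x i ω) (A a))
      = Measure.pi (fun a => poissonMeasure (μ (A a)).toNNReal)

/-! ### The network area -/

/-- The square of edge `L`. -/
def square (L : ℝ) : Set (ℝ × ℝ) := Ico 0 L ×ˢ Ico 0 L

/-- Euclidean distance on the square of edge `L` with wrap-around at the edges, i.e. on the flat
torus `(ℝ / L ℤ)²`. -/
def torusDist (L : ℝ) (ξ ζ : ℝ × ℝ) : ℝ :=
  Real.sqrt (‖((ξ.1 - ζ.1 : ℝ) : AddCircle L)‖ ^ 2 + ‖((ξ.2 - ζ.2 : ℝ) : AddCircle L)‖ ^ 2)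

/-- Homogeneous intensity measure with density `lam` on the square of edge `L`. -/
def homogeneousIntensity (L lam : ℝ) : Measure (ℝ × ℝ) :=
  ENNReal.ofReal lam • volume.restrict (square L)

/-! ### Parameters of the model, as functions of the average number `n` of nodes -/

/-- Edge length `L = n ^ γ` of the network area. -/
def edge (γ n : ℝ) : ℝ := n ^ γ

/-- Average number `m = n ^ ν` of cluster centres. -/
def clusters (ν n : ℝ) : ℝ := n ^ ν

/-- Average number `q = n ^ (1 - ν)` of nodes per cluster. -/
def perCluster (ν n : ℝ) : ℝ := n ^ (1 - ν)

/-- Typical distance `d_c = L / √m` between cluster centres. -/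
def typicalDist (γ ν n : ℝ) : ℝ := edge γ n / Real.sqrt (clusters ν n)

/-! ### The shot-noise Cox process -/

/-- Assumptions on the shape `s(ρ)`, `ρ ≥ 0`, of the shots. `0 < s 0` says that `s` does not
vanish identically, so that it can be normalized. -/
structure IsShape (s : ℝ → ℝ) : Prop where
  nonneg : ∀ ρ, 0 ≤ ρ → 0 ≤ s ρ
  pos_zero : 0 < s 0
  antitone : AntitoneOn s (Ici 0)
  continuous : ContinuousOn s (Ici 0)
  integrable : IntegrableOn (fun ρ => ρ * s ρ) (Ioi 0)

/-- The kernel `k(c, ξ) = s(‖ξ - c‖) / ∫_O s(‖ζ - c‖) dζ`. -/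
def shotKernel (s : ℝ → ℝ) (L : ℝ) (c ξ : ℝ × ℝ) : ℝ :=
  s (torusDist L ξ c) / ∫ ζ in square L, s (torusDist L ζ c)

/-- The local intensity `Φ(ξ) = ∑_{j < M} q k(c_j, ξ)` generated by cluster centres
`c 0, …, c (M - 1)`. -/
def localIntensity (γ ν : ℝ) (s : ℝ → ℝ) (n : ℝ) (M : ℕ) (c : ℕ → ℝ × ℝ) (ξ : ℝ × ℝ) : ℝ :=
  ∑ j ∈ Finset.range M, perCluster ν n * shotKernel s (edge γ n) (c j) ξ

/-- The cluster centres `c 0, …, c (M - 1)` form a homogeneous Poisson process over the network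
area, with `E[M] = m`. -/
def IsCentreProcess (γ ν n : ℝ) {Ω : Type u} [MeasurableSpace Ω] (P : Measure Ω)
    (M : Ω → ℕ) (c : ℕ → Ω → ℝ × ℝ) : Prop :=
  IsPoissonProcess P (fun ω => Finset.range (M ω)) c
    (homogeneousIntensity (edge γ n) (clusters ν n / edge γ n ^ 2))

/-- The shot-noise Cox process as a two-stage (doubly stochastic) experiment: `ω` is drawn from
`P` and determines the cluster centres, which form a homogeneous Poisson process; then `ω'` is
drawn from `κ ω` and determines the nodes `X 0, …, X (N - 1)`, which, given the centres, form
a Poisson process with intensity function `Φ`. -/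
structure IsShotNoiseCox (γ ν : ℝ) (s : ℝ → ℝ) (n : ℝ)
    {Ω : Type u} [MeasurableSpace Ω] {Ω' : Type v} [MeasurableSpace Ω']
    (P : Measure Ω) (κ : Kernel Ω Ω') (M : Ω → ℕ) (c : ℕ → Ω → ℝ × ℝ)
    (N : Ω' → ℕ) (X : ℕ → Ω' → ℝ × ℝ) : Prop where
  centres : IsCentreProcess γ ν n P M c
  nodes : ∀ᵐ ω ∂P, IsPoissonProcess (κ ω) (fun ω' => Finset.range (N ω')) X
    ((volume.restrict (square (edge γ n))).withDensity
      (fun ξ => ENNReal.ofReal (localIntensity γ ν s n (M ω) (fun j => c j ω) ξ)))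

/-! ### Statements that hold with high probability, i.e. with probability `1 - O(1/n)` -/

/-- With high probability, `Φ(ξ) > Φ₀(n)` for all `ξ` in the network area. -/
def IntensityAboveWhp (γ ν : ℝ) (s : ℝ → ℝ) (Φ₀ : ℝ → ℝ) : Prop :=
  ∃ K : ℝ, ∀ᶠ n : ℝ in atTop,
    ∀ (Ω : Type u) [MeasurableSpace Ω] (P : Measure Ω) (M : Ω → ℕ) (c : ℕ → Ω → ℝ × ℝ),
      IsCentreProcess γ ν n P M c →
      P {ω | ¬ ∀ ξ ∈ square (edge γ n),
          Φ₀ n < localIntensity γ ν s n (M ω) (fun j => c j ω) ξ} ≤ ENNReal.ofReal (K / n)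

/-- With high probability, one can extract from a realization of the shot-noise Cox process a
subset of nodes that forms a homogeneous Poisson process with intensity `Φ₀(n)`.

The extraction may use a source of randomness `(Ω'', ρ)` independent of the process. The subset
consists of the nodes with index in `Z`, and it is chosen measurably from the realization and
the extra randomness. There is an event `G` for the cluster centres, of probability
`1 - O(1/n)`, such that, given the centres, on `G`, the chosen subset is a Poisson process with
constant intensity `Φ₀(n)` on the network area. -/
def ExtractsHomogeneousWhp (γ ν : ℝ) (s : ℝ → ℝ) (Φ₀ : ℝ → ℝ) : Prop :=
  ∃ K : ℝ, ∀ᶠ n : ℝ in atTop,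
    ∀ (Ω : Type u) [MeasurableSpace Ω] (Ω' : Type v) [MeasurableSpace Ω']
      (P : Measure Ω) (κ : Kernel Ω Ω') [IsMarkovKernel κ]
      (M : Ω → ℕ) (c : ℕ → Ω → ℝ × ℝ) (N : Ω' → ℕ) (X : ℕ → Ω' → ℝ × ℝ),
      IsShotNoiseCox γ ν s n P κ M c N X →
      ∃ (Ω'' : Type) (_ : MeasurableSpace Ω'') (ρ : Measure Ω'') (_ : IsProbabilityMeasure ρ)
        (Z : Ω → Ω' × Ω'' → Finset ℕ),
        (∀ i, MeasurableSet {p : Ω × (Ω' × Ω'') | i ∈ Z p.1 p.2}) ∧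
        (∀ ω p, Z ω p ⊆ Finset.range (N p.1)) ∧
        ∃ G : Set Ω, MeasurableSet G ∧ P Gᶜ ≤ ENNReal.ofReal (K / n) ∧
          ∀ ω ∈ G, IsPoissonProcess ((κ ω).prod ρ) (Z ω) (fun i p => X i p.1)
            (homogeneousIntensity (edge γ n) (Φ₀ n))

/-- The intensity `g n / L²` of the cluster-dense condition. -/
def denseLevel (γ g n : ℝ) : ℝ := g * (n / edge γ n ^ 2)

/-- The intensity `g q log m · s(d_c √(log m))` of the cluster-sparse condition. -/
def sparseLevel (γ ν : ℝ) (s : ℝ → ℝ) (g n : ℝ) : ℝ :=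
  g * perCluster ν n * Real.log (clusters ν n)
    * s (typicalDist γ ν n * Real.sqrt (Real.log (clusters ν n)))

end SNCP

end

/-! The two parts of the statement rest on two independent ideas.

**Extraction is thinning.** On the event that `Φ > Φ₀` everywhere, retain each node `X i`
independently with probability `Φ₀ / Φ (X i)`; the retained nodes form a Poisson process with
intensity `Φ · Φ₀ / Φ = Φ₀`. As a Poisson process is only known through the joint law of the numbers
of points in disjoint sets, the thinning theorem (`IsPoissonProcess.thinning`) is proved with
generating functionals: `E ∏ f (X i) = exp ∫ (f - 1) dμ` for measurable `f` with values in the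
complex unit disc, by approximation with simple functions
(`IsPoissonProcess.integral_prod_points`). Averaging over the marks first turns the joint
generating function of the thinned counts into such an expectation, with
`f = 1 + p (b - 1)`, and a law on `ℕ ^ k` is determined by its generating function on the torus
(`ext_of_integral_prod_pow`). The event is given by an outer measure bound only, so it is
replaced by the complement of a measurable hull; this is where
`IntensityAboveWhp.extractsHomogeneousWhp` gets its measurable `G`.

**Lower bounds of `Φ` come from a partition into cells.** Divide the square into `K ^ 2` cells of
edge `L / K`. The number of centres in a cell is Poisson with mean `m / K ^ 2`, so by a Chernoff
bound all cells contain at least half of the mean, except with probability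
`K ^ 2 exp (- m / (8 K ^ 2))`. Then each point is within `2 L / K` of `m / (2 K ^ 2)` centres, each of
which contributes at least `q s (2 L / K) / C`, where `C` bounds the mass of a shot on every torus
(`IsShape.exists_integral_le`, from `∫ ρ s ρ dρ < ∞`). This is `IsShape.measure_localIntensity_lt_le`.
In the cluster-dense case the cells have constant edge, and `m / K ^ 2` grows like
`n ^ (ν - 2 γ)`; in the cluster-sparse case `m / K ^ 2` is a large multiple of `log m`, the edge is
a multiple of `d_c √(log m)`, and the power-law tail absorbs the factor in the argument of `s`. -/

namespace SNCP

/-! ### Poisson processes and generating functionals -/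

/-- A measurable family of functions, indexed by a countable type, evaluated at a random index. -/
lemma measurable_apply_random_index {Ω β ι : Type*} [MeasurableSpace Ω] [MeasurableSpace β]
    [Countable ι] {f : ι → Ω → β} {T : Ω → ι} (hT : ∀ i, MeasurableSet {ω | T ω = i})
    (hf : ∀ i, Measurable (f i)) : Measurable (fun ω => f (T ω) ω) := by
  intro B hB
  have : (fun ω => f (T ω) ω) ⁻¹' B = ⋃ i, {ω | T ω = i} ∩ f i ⁻¹' B := by
    ext ω; simp
  rw [this]
  exact MeasurableSet.iUnion fun i => (hT i).inter (hf i hB)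

lemma measurableSet_finset_eq {Ω : Type*} [MeasurableSpace Ω] {S : Ω → Finset ℕ}
    (hS : ∀ i, MeasurableSet {ω | i ∈ S ω}) (T : Finset ℕ) : MeasurableSet {ω | S ω = T} := by
  have : {ω | S ω = T} = ⋂ i, {ω | i ∈ S ω ↔ i ∈ T} := by
    ext ω; simp [Finset.ext_iff]
  rw [this]
  refine MeasurableSet.iInter fun i => ?_
  by_cases h : i ∈ T
  · simpa [h] using hS i
  · simp only [h, iff_false]
    exact (hS i).compl

lemma measurable_countIn {Ω : Type*} [MeasurableSpace Ω] {S : Ω → Finset ℕ}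
    {x : ℕ → Ω → ℝ × ℝ} (hS : ∀ i, MeasurableSet {ω | i ∈ S ω}) (hx : ∀ i, Measurable (x i))
    {A : Set (ℝ × ℝ)} (hA : MeasurableSet A) :
    Measurable (fun ω => countIn (S ω) (fun i => x i ω) A) := by
  classical
  refine measurable_apply_random_index (f := fun T ω => countIn T (fun i => x i ω) A)
    (measurableSet_finset_eq hS) fun _ => ?_
  simp only [countIn, Finset.card_filter]
  exact Finset.measurable_sum _ fun i _ =>
    Measurable.ite ((hx i) hA) measurable_const measurable_const

lemma measurable_prod_points {Ω : Type*} [MeasurableSpace Ω] {S : Ω → Finset ℕ}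
    {x : ℕ → Ω → ℝ × ℝ} (hS : ∀ i, MeasurableSet {ω | i ∈ S ω}) (hx : ∀ i, Measurable (x i))
    {f : ℝ × ℝ → ℂ} (hf : Measurable f) :
    Measurable (fun ω => ∏ i ∈ S ω, f (x i ω)) :=
  measurable_apply_random_index (f := fun T ω => ∏ i ∈ T, f (x i ω))
    (measurableSet_finset_eq hS) fun _ =>
      Finset.measurable_prod _ fun i _ => hf.comp (hx i)

lemma norm_prod_le_one {ι : Type*} (S : Finset ι) {f : ι → ℂ} (hf : ∀ i, ‖f i‖ ≤ 1) :
    ‖∏ i ∈ S, f i‖ ≤ 1 := by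
  rw [norm_prod]
  exact Finset.prod_le_one (fun i _ => norm_nonneg _) fun i _ => hf i

/-- The probability generating function of a Poisson variable. -/
lemma integral_pow_poissonMeasure (r : NNReal) (z : ℂ) :
    ∫ n, z ^ n ∂(poissonMeasure r) = Complex.exp (r * (z - 1)) := by
  rw [integral_poissonMeasure]
  have h := (NormedSpace.expSeries_div_hasSum_exp ((r : ℂ) * z)).mul_left (Complex.exp (-r))
  rw [← Complex.exp_eq_exp_ℂ, ← Complex.exp_add] at h
  rw [show (r : ℂ) * (z - 1) = -r + r * z by ring, ← h.tsum_eq]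
  refine tsum_congr fun n => ?_
  rw [Complex.real_smul, mul_pow]
  push_cast
  ring

lemma IsPoissonProcess.isProbabilityMeasure {Ω : Type*} [MeasurableSpace Ω] {P : Measure Ω}
    {S : Ω → Finset ℕ} {x : ℕ → Ω → ℝ × ℝ} {μ : Measure (ℝ × ℝ)}
    (h : IsPoissonProcess P S x μ) : IsProbabilityMeasure P := by
  have h1 := h.map_countIn 0 (fun _ => ∅) (fun _ => MeasurableSet.empty) (fun a => a.elim0)
  have h2 : AEMeasurable (fun ω (a : Fin 0) => countIn (S ω) (fun i => x i ω) ∅) P :=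
    (measurable_pi_lambda _ fun a => a.elim0).aemeasurable
  constructor
  have h3 := congrArg (fun m => m Set.univ) h1
  simpa [Measure.map_apply_of_aemeasurable h2 MeasurableSet.univ] using h3

/-- The joint probability generating function of the numbers of points in disjoint sets. -/
lemma IsPoissonProcess.integral_prod_pow {Ω : Type*} [MeasurableSpace Ω] {P : Measure Ω}
    {S : Ω → Finset ℕ} {x : ℕ → Ω → ℝ × ℝ} {μ : Measure (ℝ × ℝ)}
    (h : IsPoissonProcess P S x μ) {k : ℕ} {A : Fin k → Set (ℝ × ℝ)}
    (hA : ∀ a, MeasurableSet (A a)) (hd : Pairwise (fun a b => Disjoint (A a) (A b)))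
    (z : Fin k → ℂ) :
    ∫ ω, ∏ a, z a ^ countIn (S ω) (fun i => x i ω) (A a) ∂P
      = Complex.exp (∑ a, ((μ (A a)).toReal : ℂ) * (z a - 1)) := by
  have hm : Measurable (fun ω a => countIn (S ω) (fun i => x i ω) (A a)) :=
    measurable_pi_lambda _ fun a =>
      measurable_countIn h.measurableSet_mem h.measurable_point (hA a)
  rw [← integral_map (φ := fun ω a => countIn (S ω) (fun i => x i ω) (A a))
    (f := fun n => ∏ a, z a ^ n a) hm.aemeasurable (measurable_of_countable _).aestronglyMeasurable,
    h.map_countIn k A hA hd, integral_fintype_prod_eq_prod (fun a (n : ℕ) => z a ^ n),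
    Complex.exp_sum]
  simp_rw [integral_pow_poissonMeasure]
  rfl

/-- The generating functional at `f = g + 1` for a simple function `g`: the product is grouped by the
values of `g`. Writing `g + 1` lets `∫ (f - 1) = ∫ g` be read off the fibers of `g`. -/
lemma IsPoissonProcess.integral_prod_simpleFunc {Ω : Type*} [MeasurableSpace Ω] {P : Measure Ω}
    {S : Ω → Finset ℕ} {x : ℕ → Ω → ℝ × ℝ} {μ : Measure (ℝ × ℝ)}
    (h : IsPoissonProcess P S x μ) (g : SimpleFunc (ℝ × ℝ) ℂ) :
    ∫ ω, ∏ i ∈ S ω, (g (x i ω) + 1) ∂P = Complex.exp (∫ y, g y ∂μ) := by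
  classical
  have := IsFiniteMeasure.mk h.finite_intensity
  let e := g.range.equivFin.symm
  have h1 := h.integral_prod_pow (A := fun a => g ⁻¹' {(e a : ℂ)})
    (fun a => g.measurableSet_fiber _)
    (by
      intro a b hab
      refine Disjoint.preimage _ ?_
      simpa [Subtype.val_inj] using hab) (fun a => (e a : ℂ) + 1)
  have h2 : ∀ ω, ∏ i ∈ S ω, (g (x i ω) + 1)
      = ∏ a, ((e a : ℂ) + 1) ^ countIn (S ω) (fun i => x i ω) (g ⁻¹' {(e a : ℂ)}) := by
    intro ω
    rw [Equiv.prod_comp e (fun v : g.range =>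
      ((v : ℂ) + 1) ^ countIn (S ω) (fun i => x i ω) (g ⁻¹' {(v : ℂ)})),
      Finset.prod_coe_sort g.range
        (fun v => (v + 1) ^ countIn (S ω) (fun i => x i ω) (g ⁻¹' {v}))]
    rw [← Finset.prod_fiberwise_of_maps_to (s := S ω) (t := g.range) (g := fun i => g (x i ω))
      (fun i _ => g.mem_range_self _)]
    refine Finset.prod_congr rfl fun v _ => ?_
    rw [Finset.prod_congr rfl (g := fun _ => v + 1)
      (by intro i hi; simpa using (Finset.mem_filter.1 hi).2), Finset.prod_const, countIn]
    congr 2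
  simp_rw [h2]
  rw [h1, ← SimpleFunc.integral_eq_integral g (SimpleFunc.integrable_of_isFiniteMeasure _),
    SimpleFunc.integral_eq]
  congr 1
  rw [Equiv.sum_comp e (fun v : g.range =>
      ((μ (g ⁻¹' {(v : ℂ)})).toReal : ℂ) * ((v : ℂ) + 1 - 1)),
    Finset.sum_coe_sort g.range (fun v => ((μ (g ⁻¹' {v})).toReal : ℂ) * (v + 1 - 1))]
  refine Finset.sum_congr rfl fun v _ => ?_
  rw [add_sub_cancel_right, Complex.real_smul]
  rfl

/-- The probability generating functional of a Poisson process, for complex test functions in the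
unit disc. -/
theorem IsPoissonProcess.integral_prod_points {Ω : Type*} [MeasurableSpace Ω] {P : Measure Ω}
    {S : Ω → Finset ℕ} {x : ℕ → Ω → ℝ × ℝ} {μ : Measure (ℝ × ℝ)}
    (h : IsPoissonProcess P S x μ) {f : ℝ × ℝ → ℂ} (hf : Measurable f) (hb : ∀ y, ‖f y‖ ≤ 1) :
    ∫ ω, ∏ i ∈ S ω, f (x i ω) ∂P = Complex.exp (∫ y, (f y - 1) ∂μ) := by
  have := IsFiniteMeasure.mk h.finite_intensity
  have := h.isProbabilityMeasure
  have hs : StronglyMeasurable f := hf.stronglyMeasurable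
  let F : ℕ → SimpleFunc (ℝ × ℝ) ℂ := hs.approxBounded 1
  have hF : ∀ n y, ‖F n y‖ ≤ 1 := fun n y => hs.norm_approxBounded_le zero_le_one n y
  have hlim : ∀ y, Tendsto (fun n => F n y) atTop (nhds (f y)) :=
    fun y => hs.tendsto_approxBounded_of_norm_le (hb y)
  have h1 : ∀ n, ∫ ω, ∏ i ∈ S ω, F n (x i ω) ∂P = Complex.exp (∫ y, (F n y - 1) ∂μ) := by
    intro n
    have := h.integral_prod_simpleFunc ((F n).map (fun z => z - 1))
    simpa using this
  have h2 : Tendsto (fun n => ∫ ω, ∏ i ∈ S ω, F n (x i ω) ∂P) atTop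
      (nhds (∫ ω, ∏ i ∈ S ω, f (x i ω) ∂P)) := by
    refine tendsto_integral_of_dominated_convergence (fun _ => 1)
      (fun n => (measurable_prod_points h.measurableSet_mem h.measurable_point
        (F n).measurable).aestronglyMeasurable) (integrable_const _)
      (fun n => .of_forall fun ω => norm_prod_le_one _ fun i => hF n _)
      (.of_forall fun ω => tendsto_finsetProd _ fun i _ => hlim _)
  have h3 : Tendsto (fun n => ∫ y, (F n y - 1) ∂μ) atTop (nhds (∫ y, (f y - 1) ∂μ)) := by
    refine tendsto_integral_of_dominated_convergence (fun _ => 2)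
      (fun n => ((F n).measurable.sub_const 1).aestronglyMeasurable) (integrable_const _)
      (fun n => .of_forall fun y => ?_) (.of_forall fun y => (hlim y).sub_const 1)
    calc ‖F n y - 1‖ ≤ ‖F n y‖ + ‖(1 : ℂ)‖ := norm_sub_le _ _
      _ ≤ 2 := by rw [norm_one]; linarith [hF n y]
  refine tendsto_nhds_unique h2 ?_
  simp_rw [h1]
  exact (Complex.continuous_exp.tendsto _).comp h3

/-- A finite measure on `ℕ ^ k` is determined by its probability generating function on the
torus `|z a| = 1`. -/
theorem ext_of_integral_prod_pow {k : ℕ} {μ ν : Measure (Fin k → ℕ)} [IsFiniteMeasure μ]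
    [IsFiniteMeasure ν]
    (h : ∀ z : Fin k → ℂ, (∀ a, ‖z a‖ = 1) →
      ∫ n, ∏ a, z a ^ n a ∂μ = ∫ n, ∏ a, z a ^ n a ∂ν) : μ = ν := by
  let φ : (Fin k → ℕ) → EuclideanSpace ℝ (Fin k) := fun n => WithLp.toLp 2 fun a => (n a : ℝ)
  have hφ : Measurable φ := measurable_of_countable _
  have hφi : Function.Injective φ := by
    intro n m hnm
    funext a
    have : φ n a = φ m a := by rw [hnm]
    simpa [φ] using this
  have key : μ.map φ = ν.map φ := by
    refine Measure.ext_of_charFun (funext fun t => ?_)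
    have : ∀ m : Measure (Fin k → ℕ), charFun (m.map φ) t
        = ∫ n, ∏ a, Complex.exp (t a * Complex.I) ^ n a ∂m := by
      intro m
      rw [charFun_apply, integral_map hφ.aemeasurable (by fun_prop)]
      refine integral_congr_ae (.of_forall fun n => ?_)
      simp only [φ, PiLp.inner_apply, ← Complex.exp_nat_mul, ← Complex.exp_sum]
      simp only [RCLike.inner_apply, conj_trivial, Complex.ofReal_sum, Complex.ofReal_mul,
        Complex.ofReal_natCast, Finset.sum_mul]
      congr 1
      exact Finset.sum_congr rfl fun a _ => by ring
    rw [this, this]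
    exact h _ fun a => Complex.norm_exp_ofReal_mul_I _
  have hem : MeasurableEmbedding φ :=
    { injective := hφi, measurable := hφ,
      measurableSet_image' := fun _ _ => ((Set.to_countable _).image φ).measurableSet }
  rw [← hem.comap_map μ, key, hem.comap_map]

/-! ### Independent thinning -/

lemma integral_prod_infinitePi {X : Type*} [MeasurableSpace X] (m : Measure X)
    [IsProbabilityMeasure m] (T : Finset ℕ) {g : ℕ → X → ℂ} (hg : ∀ i, Measurable (g i)) :
    ∫ u, ∏ i ∈ T, g i (u i) ∂(Measure.infinitePi fun _ : ℕ => m) = ∏ i ∈ T, ∫ t, g i t ∂m := by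
  have h1 := integral_restrict_infinitePi (μ := fun _ : ℕ => m) (s := T)
    (f := fun y : (i : T) → X => ∏ i : T, g i (y i))
    (Finset.measurable_prod _ fun (i : T) _ =>
      (hg i).comp (measurable_pi_apply (X := fun _ : T => X) i)).aestronglyMeasurable
  rw [integral_fintype_prod_eq_prod (fun (i : T) (y : X) => g i y)] at h1
  rw [← Finset.prod_coe_sort T (fun i => ∫ t, g i t ∂m), ← h1]
  refine integral_congr_ae (.of_forall fun u => ?_)
  exact (Finset.prod_coe_sort T (fun i => g i (u i))).symm

lemma integral_ite_lt_unitInterval (p : unitInterval) (b : ℂ) :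
    ∫ t : unitInterval, (if t < p then b else 1) = 1 + (p : ℝ) * (b - 1) := by
  have h1 : ∀ t : unitInterval,
      (if t < p then b else 1) = 1 + (Iio p).indicator (fun _ => b - 1) t := by
    intro t
    by_cases h : t < p <;> simp [h]
  simp_rw [h1]
  rw [integral_add (integrable_const _) ((integrable_const _).indicator measurableSet_Iio),
    integral_indicator_const _ measurableSet_Iio]
  simp [Measure.real, p.2.1]

/-- The indices of the points that survive the thinning with retention probability `p`, when the
mark of the `i`-th point is `u i`. -/
noncomputable def thinning (p : ℝ × ℝ → unitInterval) (S : Finset ℕ) (x : ℕ → ℝ × ℝ)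
    (u : ℕ → unitInterval) : Finset ℕ :=
  open Classical in S.filter fun i => u i < p (x i)

lemma mem_thinning {p : ℝ × ℝ → unitInterval} {S : Finset ℕ} {x : ℕ → ℝ × ℝ}
    {u : ℕ → unitInterval} {i : ℕ} : i ∈ thinning p S x u ↔ i ∈ S ∧ u i < p (x i) := by
  simp [thinning]

lemma measurableSet_mem_thinning {Ω : Type*} [MeasurableSpace Ω] {S : Ω → Finset ℕ}
    {x : ℕ → Ω → ℝ × ℝ} {u : Ω → ℕ → unitInterval} {p : Ω → ℝ × ℝ → unitInterval}
    (hS : ∀ i, MeasurableSet {ω | i ∈ S ω}) (hx : ∀ i, Measurable (x i)) (hu : Measurable u)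
    (hp : Measurable fun y : Ω × (ℝ × ℝ) => p y.1 y.2) (i : ℕ) :
    MeasurableSet {ω | i ∈ thinning (p ω) (S ω) (fun i => x i ω) (u ω)} := by
  simp only [mem_thinning]
  have h1 : MeasurableSet {ω | u ω i < p ω (x i ω)} :=
    measurableSet_lt ((measurable_pi_apply i).comp hu) (hp.comp (measurable_id.prodMk (hx i)))
  exact (hS i).inter h1

/-- The source of randomness of a thinning: independent uniform marks. -/
noncomputable abbrev uniformMarks : Measure (ℕ → unitInterval) :=
  Measure.infinitePi fun _ : ℕ => (volume : Measure unitInterval)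

/-- Thinning theorem: if each point `y` of a Poisson process with intensity `μ` is retained
independently with probability `p y`, the retained points form a Poisson process with intensity
`p • μ`. -/
theorem IsPoissonProcess.thinning {Ω : Type*} [MeasurableSpace Ω] {P : Measure Ω}
    {S : Ω → Finset ℕ} {x : ℕ → Ω → ℝ × ℝ} {μ : Measure (ℝ × ℝ)}
    (h : IsPoissonProcess P S x μ) {p : ℝ × ℝ → unitInterval} (hp : Measurable p) :
    IsPoissonProcess (P.prod uniformMarks)
      (fun q => SNCP.thinning p (S q.1) (fun i => x i q.1) q.2) (fun i q => x i q.1)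
      (μ.withDensity fun y => ENNReal.ofReal (p y)) := by
  classical
  have := IsFiniteMeasure.mk h.finite_intensity
  have := h.isProbabilityMeasure
  have hpr : Measurable (fun y => (p y : ℝ)) := measurable_subtype_coe.comp hp
  have hpi : Integrable (fun y => (p y : ℝ)) μ :=
    Integrable.of_bound hpr.aestronglyMeasurable 1
      (.of_forall fun y => by
        rw [Real.norm_of_nonneg (p y).2.1]; exact (p y).2.2)
  have hX : ∀ i, Measurable fun q : Ω × (ℕ → unitInterval) => x i q.1 :=
    fun i => (h.measurable_point i).comp measurable_fst
  have hZ : ∀ i, MeasurableSet {q : Ω × (ℕ → unitInterval) |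
      i ∈ SNCP.thinning p (S q.1) (fun i => x i q.1) q.2} :=
    measurableSet_mem_thinning (p := fun _ => p)
      (fun i => measurable_fst (h.measurableSet_mem i)) hX measurable_snd (hp.comp measurable_snd)
  have hint : ∀ A, MeasurableSet A →
      (μ.withDensity fun y => ENNReal.ofReal (p y)) A = ENNReal.ofReal (∫ y in A, (p y : ℝ) ∂μ) := by
    intro A hA
    rw [withDensity_apply _ hA, ofReal_integral_eq_lintegral_ofReal hpi.integrableOn
      (.of_forall fun y => (p y).2.1)]
  refine ⟨hZ, hX, by rw [hint _ MeasurableSet.univ]; exact ENNReal.ofReal_lt_top, ?_⟩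
  intro k A hA hd
  have hm : Measurable (fun (q : Ω × (ℕ → unitInterval)) a =>
      countIn (SNCP.thinning p (S q.1) (fun i => x i q.1) q.2) (fun i => x i q.1) (A a)) :=
    measurable_pi_lambda _ fun a => measurable_countIn hZ hX (hA a)
  have := Measure.isProbabilityMeasure_map (μ := P.prod uniformMarks) hm.aemeasurable
  refine ext_of_integral_prod_pow fun z hz => ?_
  rw [integral_map hm.aemeasurable (measurable_of_countable _).aestronglyMeasurable,
    integral_fintype_prod_eq_prod (fun a (n : ℕ) => z a ^ n)]
  simp_rw [integral_pow_poissonMeasure]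
  rw [← Complex.exp_sum]
  -- the factor that a retained point at `y` contributes to the generating function
  let b : ℝ × ℝ → ℂ := fun y => ∏ a, if y ∈ A a then z a else 1
  have hb : Measurable b :=
    Finset.measurable_prod _ fun a _ => Measurable.ite (hA a) measurable_const measurable_const
  have hb1 : ∀ y, ‖b y‖ = 1 := by
    intro y
    simp only [b, norm_prod]
    exact Finset.prod_eq_one fun a _ => by split_ifs <;> simp [hz]
  have hbz : ∀ y, b y - 1 = ∑ a, (A a).indicator (fun _ => z a - 1) y := by
    intro y
    by_cases hy : ∃ a, y ∈ A a
    · obtain ⟨a, ha⟩ := hy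
      have hne : ∀ c, c ≠ a → y ∉ A c := fun c hc hyc =>
        Set.disjoint_left.1 (hd hc) hyc ha
      simp only [b]
      rw [Finset.prod_eq_single a (fun c _ hc => by simp [hne c hc]) (by simp),
        Finset.sum_eq_single a (fun c _ hc => by simp [hne c hc]) (by simp)]
      simp [ha]
    · push Not at hy
      simp [b, hy]
  have hprod : ∀ q : Ω × (ℕ → unitInterval), ∏ a, z a ^ countIn
      (SNCP.thinning p (S q.1) (fun i => x i q.1) q.2) (fun i => x i q.1) (A a)
      = ∏ i ∈ S q.1, (if q.2 i < p (x i q.1) then b (x i q.1) else 1) := by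
    intro q
    rw [← Finset.prod_filter]
    simp only [b]
    rw [Finset.prod_comm]
    refine Finset.prod_congr rfl fun a _ => ?_
    rw [← Finset.prod_filter, Finset.prod_const, countIn]
    congr 2
  simp_rw [hprod]
  have hmeas : Measurable fun q : Ω × (ℕ → unitInterval) =>
      ∏ i ∈ S q.1, (if q.2 i < p (x i q.1) then b (x i q.1) else 1) := by
    refine measurable_apply_random_index (f := fun T (q : Ω × (ℕ → unitInterval)) =>
      ∏ i ∈ T, (if q.2 i < p (x i q.1) then b (x i q.1) else 1)) (T := fun q => S q.1)
      (fun T => measurable_fst (measurableSet_finset_eq h.measurableSet_mem T)) fun T => ?_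
    refine Finset.measurable_prod _ fun i _ => Measurable.ite
      (measurableSet_lt ((measurable_pi_apply i).comp measurable_snd) (hp.comp (hX i)))
      (hb.comp (hX i)) measurable_const
  rw [integral_prod _ (Integrable.of_bound hmeas.aestronglyMeasurable 1 (.of_forall fun q =>
    norm_prod_le_one _ fun i => by split_ifs <;> simp [hb1]))]
  have hinner : ∀ ω, ∫ u, ∏ i ∈ S ω, (if u i < p (x i ω) then b (x i ω) else 1) ∂uniformMarks
      = ∏ i ∈ S ω, (1 + (p (x i ω) : ℝ) * (b (x i ω) - 1)) := by
    intro ω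
    rw [integral_prod_infinitePi volume (S ω)
      (g := fun i t => if t < p (x i ω) then b (x i ω) else 1)
      (fun i => Measurable.ite measurableSet_Iio measurable_const measurable_const)]
    simp_rw [integral_ite_lt_unitInterval]
  simp_rw [hinner]
  rw [h.integral_prod_points (f := fun y => 1 + ((p y : ℝ) : ℂ) * (b y - 1))]
  · congr 1
    simp_rw [add_sub_cancel_left, hbz, Finset.mul_sum]
    have hind : ∀ a y, ((p y : ℝ) : ℂ) * (A a).indicator (fun _ => z a - 1) y
        = (A a).indicator (fun y => ((p y : ℝ) : ℂ) * (z a - 1)) y := by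
      intro a y
      by_cases hy : y ∈ A a <;> simp [hy]
    simp_rw [hind]
    rw [integral_finsetSum _ fun a _ => (hpi.ofReal.mul_const _).indicator (hA a)]
    refine Finset.sum_congr rfl fun a _ => ?_
    rw [integral_indicator (hA a), integral_mul_const, integral_complex_ofReal, hint _ (hA a)]
    congr 2
    exact (Real.coe_toNNReal _ (integral_nonneg fun y => (p y).2.1)).symm
  · exact measurable_const.add ((Complex.measurable_ofReal.comp hpr).mul (hb.sub_const 1))
  · intro y
    have h0 := (p y).2.1
    have h1 := (p y).2.2
    calc ‖1 + ((p y : ℝ) : ℂ) * (b y - 1)‖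
        = ‖((1 - (p y : ℝ) : ℝ) : ℂ) + ((p y : ℝ) : ℂ) * b y‖ := by
          congr 1; push_cast; ring
      _ ≤ (1 - (p y : ℝ)) + (p y : ℝ) := by
          refine (norm_add_le _ _).trans (add_le_add ?_ ?_)
          · rw [Complex.norm_real, Real.norm_of_nonneg (by linarith)]
          · rw [norm_mul, hb1, mul_one, Complex.norm_real, Real.norm_of_nonneg h0]
      _ = 1 := by ring

/-! ### The local intensity as a measurable function, and the extraction -/

lemma measurableSet_square (L : ℝ) : MeasurableSet (square L) :=
  measurableSet_Ico.prod measurableSet_Ico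

lemma continuous_torusDist (L : ℝ) :
    Continuous fun y : (ℝ × ℝ) × (ℝ × ℝ) => torusDist L y.1 y.2 := by
  have hc : Continuous fun t : ℝ => (t : AddCircle L) := continuous_quotient_mk'
  unfold torusDist
  exact Real.continuous_sqrt.comp
    (((hc.comp (by fun_prop)).norm.pow 2).add ((hc.comp (by fun_prop)).norm.pow 2))

lemma torusDist_nonneg (L : ℝ) (ξ ζ : ℝ × ℝ) : 0 ≤ torusDist L ξ ζ := Real.sqrt_nonneg _

lemma IsShape.continuous_comp_torusDist {s : ℝ → ℝ} (hs : IsShape s) (L : ℝ) :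
    Continuous fun y : (ℝ × ℝ) × (ℝ × ℝ) => s (torusDist L y.1 y.2) :=
  hs.continuous.comp_continuous (continuous_torusDist L) fun _ => torusDist_nonneg _ _ _

lemma IsShape.measurable_shotKernel {s : ℝ → ℝ} (hs : IsShape s) (L : ℝ) :
    Measurable fun y : (ℝ × ℝ) × (ℝ × ℝ) => shotKernel s L y.1 y.2 := by
  have h1 : StronglyMeasurable fun y : (ℝ × ℝ) × (ℝ × ℝ) => s (torusDist L y.1 y.2) :=
    (hs.continuous_comp_torusDist L).stronglyMeasurable
  have h2 : Measurable fun c : ℝ × ℝ => ∫ ζ in square L, s (torusDist L ζ c) :=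
    (h1.integral_prod_left' (μ := volume.restrict (square L))).measurable
  exact (h1.measurable.comp measurable_swap).div (h2.comp measurable_fst)

lemma IsShape.measurable_localIntensity {s : ℝ → ℝ} (hs : IsShape s) (γ ν n : ℝ) {Ω : Type*}
    [MeasurableSpace Ω] {M : Ω → ℕ} {c : ℕ → Ω → ℝ × ℝ}
    (hM : ∀ i, MeasurableSet {ω | i ∈ Finset.range (M ω)}) (hc : ∀ i, Measurable (c i)) :
    Measurable fun y : Ω × (ℝ × ℝ) => localIntensity γ ν s n (M y.1) (fun j => c j y.1) y.2 := by
  have hM' : ∀ k, MeasurableSet {y : Ω × (ℝ × ℝ) | M y.1 = k} := by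
    intro k
    have h1 : {ω | M ω = k} = {ω | Finset.range (M ω) = Finset.range k} := by
      ext ω; exact ⟨fun h => congrArg _ h, fun h => by simpa using congrArg Finset.card h⟩
    have h2 : MeasurableSet {ω | M ω = k} := h1 ▸ measurableSet_finset_eq hM (Finset.range k)
    exact measurable_fst h2
  refine measurable_apply_random_index (T := fun y : Ω × (ℝ × ℝ) => M y.1)
    (f := fun k (y : Ω × (ℝ × ℝ)) => localIntensity γ ν s n k (fun j => c j y.1) y.2) hM' fun k => ?_
  unfold localIntensity
  exact Finset.measurable_sum _ fun j _ => ((hs.measurable_shotKernel _).comp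
    (((hc j).comp measurable_fst).prodMk measurable_snd)).const_mul _

/-- The retention probability that turns the intensity `φ` into the intensity `a`, truncated to
`[0, 1]`. -/
noncomputable def retention (a φ : ℝ) : unitInterval :=
  Set.projIcc 0 1 zero_le_one (a / φ)

lemma measurable_retention (a : ℝ) : Measurable (retention a) :=
  continuous_projIcc.measurable.comp (measurable_const.div measurable_id)

/-- Holds for levels and intensities of any sign, as `ENNReal.ofReal` truncates at `0`. -/
lemma ofReal_mul_retention {a φ : ℝ} (h : a < φ) :
    ENNReal.ofReal φ * ENNReal.ofReal (retention a φ) = ENNReal.ofReal a := by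
  rcases le_or_gt φ 0 with hφ | hφ
  · rw [ENNReal.ofReal_of_nonpos hφ, ENNReal.ofReal_of_nonpos (h.le.trans hφ), zero_mul]
  rcases le_or_gt a 0 with ha | ha
  · have : retention a φ = 0 :=
      Set.projIcc_of_le_left _ (div_nonpos_of_nonpos_of_nonneg ha hφ.le)
    simp [this, ENNReal.ofReal_of_nonpos ha]
  · have hm : a / φ ∈ Icc (0 : ℝ) 1 := ⟨by positivity, (div_le_one hφ).2 h.le⟩
    have : (retention a φ : ℝ) = a / φ := by
      rw [retention, Set.projIcc_of_mem _ hm]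
    rw [this, ← ENNReal.ofReal_mul hφ.le, mul_div_cancel₀ _ hφ.ne']

/-- Extraction by thinning: a node at `ξ` is retained with probability `Φ₀ / Φ ξ`. -/
theorem IntensityAboveWhp.extractsHomogeneousWhp {γ ν : ℝ} {s : ℝ → ℝ} (hs : IsShape s)
    {Φ₀ : ℝ → ℝ} (h : IntensityAboveWhp.{u} γ ν s Φ₀) :
    ExtractsHomogeneousWhp.{u, v} γ ν s Φ₀ := by
  obtain ⟨K, hK⟩ := h
  refine ⟨K, hK.mono ?_⟩
  intro n hn Ω _ Ω' _ P κ _ M c N X hX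
  have hP := hX.centres.isProbabilityMeasure
  specialize hn Ω P M c hX.centres
  set L := edge γ n
  have hnodes := hX.nodes
  obtain ⟨Φ, hΦ, hΦe⟩ : ∃ Φ : Ω → ℝ × ℝ → ℝ, Measurable (fun y : Ω × (ℝ × ℝ) => Φ y.1 y.2) ∧
      ∀ ω ξ, localIntensity γ ν s n (M ω) (fun j => c j ω) ξ = Φ ω ξ :=
    ⟨_, hs.measurable_localIntensity γ ν n hX.centres.measurableSet_mem hX.centres.measurable_point,
      fun _ _ => rfl⟩
  simp only [hΦe] at hn hnodes
  obtain ⟨p, hp, hpΦ⟩ : ∃ p : Ω → ℝ × ℝ → unitInterval,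
      Measurable (fun y : Ω × (ℝ × ℝ) => p y.1 y.2) ∧
      ∀ ω ξ, p ω ξ = retention (Φ₀ n) (Φ ω ξ) :=
    ⟨fun ω ξ => retention (Φ₀ n) (Φ ω ξ), (measurable_retention _).comp hΦ, fun _ _ => rfl⟩
  obtain ⟨ω₀, hω₀⟩ := hnodes.exists
  refine ⟨ℕ → unitInterval, inferInstance, uniformMarks, inferInstance, fun ω q =>
    thinning (p ω) (Finset.range (N q.1)) (fun i => X i q.1) q.2,
    ?_, fun ω q i hi => (mem_thinning.1 hi).1, ?_⟩
  · intro i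
    exact measurableSet_mem_thinning (S := fun y : Ω × Ω' × (ℕ → unitInterval) =>
      Finset.range (N y.2.1)) (x := fun i y => X i y.2.1) (u := fun y => y.2.2)
      (p := fun y => p y.1)
      (fun i => (measurable_fst.comp measurable_snd) (hω₀.measurableSet_mem i))
      (fun i => (hω₀.measurable_point i).comp (measurable_fst.comp measurable_snd))
      (measurable_snd.comp measurable_snd)
      (hp.comp ((measurable_fst.comp measurable_fst).prodMk measurable_snd)) i
  · -- Neither exceptional set is known to be measurable, so measurable hulls are removed.
    let B : Set Ω := toMeasurable P {ω | ¬ ∀ ξ ∈ square L, Φ₀ n < Φ ω ξ}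
    let B' : Set Ω := toMeasurable P {ω | ¬ IsPoissonProcess (κ ω)
      (fun ω' => Finset.range (N ω')) X ((volume.restrict (square L)).withDensity fun ξ => ENNReal.ofReal (Φ ω ξ))}
    have hB' : P B' = 0 := by
      rw [measure_toMeasurable]; exact ae_iff.1 hnodes
    refine ⟨(B ∪ B')ᶜ, ((measurableSet_toMeasurable _ _).union
      (measurableSet_toMeasurable _ _)).compl, ?_, ?_⟩
    · rw [compl_compl]
      calc P (B ∪ B') ≤ P B + P B' := measure_union_le _ _
        _ = P B := by rw [hB', add_zero]
        _ ≤ _ := by rw [measure_toMeasurable]; exact hn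
    · intro ω hω
      rw [mem_compl_iff, mem_union, not_or] at hω
      have h1 : ∀ ξ ∈ square L, Φ₀ n < Φ ω ξ := by
        by_contra hc
        exact hω.1 (subset_toMeasurable P _ hc)
      have h2 : IsPoissonProcess (κ ω) (fun ω' => Finset.range (N ω')) X
          ((volume.restrict (square L)).withDensity fun ξ => ENNReal.ofReal (Φ ω ξ)) := by
        by_contra hc
        exact hω.2 (subset_toMeasurable P _ hc)
      have hΦω : Measurable (Φ ω) := hΦ.comp measurable_prodMk_left
      have hpω : Measurable (p ω) := hp.comp measurable_prodMk_left
      have h3 := h2.thinning hpω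
      have h4 : ((volume.restrict (square L)).withDensity
          fun ξ => ENNReal.ofReal (Φ ω ξ)).withDensity
            (fun ξ => ENNReal.ofReal (p ω ξ))
          = homogeneousIntensity L (Φ₀ n) := by
        have hpr : Measurable fun ξ => (p ω ξ : ℝ) := measurable_subtype_coe.comp hpω
        rw [← withDensity_mul _ hΦω.ennreal_ofReal hpr.ennreal_ofReal, homogeneousIntensity,
          ← withDensity_const]
        refine withDensity_congr_ae ?_
        filter_upwards [ae_restrict_mem (measurableSet_square L)] with ξ hξ
        rw [Pi.mul_apply, hpΦ]
        exact ofReal_mul_retention (h1 ξ hξ)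
      rwa [h4] at h3

/-! ### Bounds for the shot kernel -/

lemma norm_coe_addCircle_le (L t : ℝ) : ‖(t : AddCircle L)‖ ≤ |t| := by
  simpa using QuotientAddGroup.norm_mk_le_norm (S := AddSubgroup.zmultiples L) (m := t)

lemma torusDist_le (L : ℝ) (ξ ζ : ℝ × ℝ) :
    torusDist L ξ ζ ≤ |ξ.1 - ζ.1| + |ξ.2 - ζ.2| := by
  have h1 := norm_coe_addCircle_le L (ξ.1 - ζ.1)
  have h2 := norm_coe_addCircle_le L (ξ.2 - ζ.2)
  have h3 := norm_nonneg ((ξ.1 - ζ.1 : ℝ) : AddCircle L)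
  have h4 := norm_nonneg ((ξ.2 - ζ.2 : ℝ) : AddCircle L)
  refine Real.sqrt_le_iff.2 ⟨by positivity, ?_⟩
  nlinarith [mul_nonneg (h3.trans h1) (h4.trans h2), pow_le_pow_left₀ h3 h1 2,
    pow_le_pow_left₀ h4 h2 2]

/-- The wrap-around distance of two points of `[0, L)` is realized by a shift by `-L`, `0` or
`L`. -/
lemma exists_abs_sub_eq_norm {L x y : ℝ} (hL : 0 < L) (hx : x ∈ Ico 0 L) (hy : y ∈ Ico 0 L) :
    ∃ k ∈ Finset.Icc (-1 : ℤ) 1, |x - y - k * L| = ‖((x - y : ℝ) : AddCircle L)‖ := by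
  refine ⟨round (L⁻¹ * (x - y)), ?_, (AddCircle.norm_eq L).symm⟩
  have h1 := abs_le.1 (abs_sub_round (L⁻¹ * (x - y)))
  have h2 : L⁻¹ * (x - y) < 1 := by
    rw [inv_mul_lt_iff₀ hL]; linarith [hx.2, hy.1]
  have h3 : -1 < L⁻¹ * (x - y) := by
    rw [lt_inv_mul_iff₀ hL]; linarith [hx.1, hy.2]
  have h4 : ((round (L⁻¹ * (x - y)) : ℤ) : ℝ) < ((2 : ℤ) : ℝ) := by push_cast; linarith
  have h5 : ((-2 : ℤ) : ℝ) < ((round (L⁻¹ * (x - y)) : ℤ) : ℝ) := by push_cast; linarith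
  rw [Int.cast_lt] at h4 h5
  rw [Finset.mem_Icc]
  omega

lemma IsShape.integrable_comp_norm {s : ℝ → ℝ} (hs : IsShape s) :
    Integrable fun x : ℝ × ℝ => s ‖x‖ := by
  rw [integrable_fun_norm_addHaar (volume : Measure (ℝ × ℝ)) (f := s)]
  simpa using hs.integrable

/-- The total mass of a shot is bounded uniformly in the size of the torus: it is at most the mass
of nine translates of `x ↦ s ‖x‖` on the plane, as the maximum norm is below the Euclidean one. -/
lemma IsShape.exists_integral_le {s : ℝ → ℝ} (hs : IsShape s) :
    ∃ C : ℝ, 0 < C ∧ ∀ L : ℝ, 0 < L → ∀ c ∈ square L,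
      ∫ ζ in square L, s (torusDist L ζ c) ≤ C := by
  have hs0 : ∀ x : ℝ × ℝ, 0 ≤ s ‖x‖ := fun x => hs.nonneg _ (norm_nonneg _)
  have hJ : 0 ≤ ∫ x : ℝ × ℝ, s ‖x‖ := integral_nonneg hs0
  refine ⟨9 * (∫ x : ℝ × ℝ, s ‖x‖) + 1, by positivity, fun L hL c hc => ?_⟩
  let I : Finset (ℤ × ℤ) := Finset.Icc (-1 : ℤ) 1 ×ˢ Finset.Icc (-1 : ℤ) 1
  let v : ℤ × ℤ → ℝ × ℝ := fun k => c + (k.1 * L, k.2 * L)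
  have hint : ∀ k, Integrable fun ζ : ℝ × ℝ => s ‖ζ - v k‖ :=
    fun k => hs.integrable_comp_norm.comp_sub_right (v k)
  have hpt : ∀ ζ ∈ square L, s (torusDist L ζ c) ≤ ∑ k ∈ I, s ‖ζ - v k‖ := by
    intro ζ hζ
    obtain ⟨k, hk, hk'⟩ := exists_abs_sub_eq_norm hL hζ.1 hc.1
    obtain ⟨l, hl, hl'⟩ := exists_abs_sub_eq_norm hL hζ.2 hc.2
    have hle : ‖ζ - v (k, l)‖ ≤ torusDist L ζ c := by
      rw [Prod.norm_def, max_le_iff]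
      constructor
      · refine Real.le_sqrt_of_sq_le ?_
        rw [← hk', Real.norm_eq_abs]
        have : (ζ - v (k, l)).1 = ζ.1 - c.1 - k * L := by simp [v]; ring
        rw [this]
        nlinarith [sq_nonneg ‖((ζ.2 - c.2 : ℝ) : AddCircle L)‖]
      · refine Real.le_sqrt_of_sq_le ?_
        rw [← hl', Real.norm_eq_abs]
        have : (ζ - v (k, l)).2 = ζ.2 - c.2 - l * L := by simp [v]; ring
        rw [this]
        nlinarith [sq_nonneg ‖((ζ.1 - c.1 : ℝ) : AddCircle L)‖]
    exact (hs.antitone (norm_nonneg _) (torusDist_nonneg _ _ _) hle).trans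
      (Finset.single_le_sum (f := fun k => s ‖ζ - v k‖) (fun k _ => hs0 _)
        (Finset.mk_mem_product hk hl))
  have hnn : ∀ᵐ ζ ∂(volume.restrict (square L)), 0 ≤ s (torusDist L ζ c) :=
    .of_forall fun ζ => hs.nonneg _ (torusDist_nonneg _ _ _)
  calc ∫ ζ in square L, s (torusDist L ζ c)
      ≤ ∫ ζ in square L, ∑ k ∈ I, s ‖ζ - v k‖ :=
        integral_mono_of_nonneg hnn
          (integrable_finsetSum _ fun k _ => (hint k).integrableOn)
          ((ae_restrict_mem (measurableSet_square L)).mono hpt)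
    _ = ∑ k ∈ I, ∫ ζ in square L, s ‖ζ - v k‖ :=
        integral_finsetSum _ fun k _ => (hint k).integrableOn
    _ ≤ ∑ k ∈ I, ∫ x : ℝ × ℝ, s ‖x‖ := by
        refine Finset.sum_le_sum fun k _ => ?_
        rw [← integral_sub_right_eq_self (fun x : ℝ × ℝ => s ‖x‖) (v k)]
        exact setIntegral_le_integral (hint k) (.of_forall fun ζ => hs0 _)
    _ = 9 * ∫ x : ℝ × ℝ, s ‖x‖ := by
        rw [Finset.sum_const, Finset.card_product]
        simp
    _ ≤ _ := by linarith

lemma IsShape.exists_pos {s : ℝ → ℝ} (hs : IsShape s) : ∃ r, 0 < r ∧ 0 < s r := by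
  have h1 : Tendsto s (nhdsWithin 0 (Ioi 0)) (nhds (s 0)) :=
    ((hs.continuous 0 self_mem_Ici).mono Ioi_subset_Ici_self).tendsto
  have h2 : ∀ᶠ r in nhdsWithin (0 : ℝ) (Ioi 0), 0 < s r :=
    h1.eventually (lt_mem_nhds hs.pos_zero)
  have h3 : ∀ᶠ r in nhdsWithin (0 : ℝ) (Ioi 0), 0 < r := eventually_mem_nhdsWithin
  exact (h3.and h2).exists

/-- The normalization of the shot kernel does not divide by zero. -/
lemma IsShape.integral_pos {s : ℝ → ℝ} (hs : IsShape s) {L : ℝ} {c : ℝ × ℝ} (hc : c ∈ square L) :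
    0 < ∫ ζ in square L, s (torusDist L ζ c) := by
  obtain ⟨r, hr, hsr⟩ := hs.exists_pos
  have hcont : Continuous fun ζ : ℝ × ℝ => s (torusDist L ζ c) :=
    (hs.continuous_comp_torusDist L).comp (f := fun ζ : ℝ × ℝ => (ζ, c)) (by fun_prop)
  have hnn : ∀ ζ, 0 ≤ s (torusDist L ζ c) := fun ζ => hs.nonneg _ (torusDist_nonneg _ _ _)
  have hfin : volume (square L) < ⊤ := by
    rw [square, Measure.volume_eq_prod, Measure.prod_prod, Real.volume_Ico]
    exact ENNReal.mul_lt_top ENNReal.ofReal_lt_top ENNReal.ofReal_lt_top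
  have hint : IntegrableOn (fun ζ : ℝ × ℝ => s (torusDist L ζ c)) (square L) := by
    have : IsFiniteMeasure (volume.restrict (square L)) :=
      ⟨by rwa [Measure.restrict_apply_univ]⟩
    refine Integrable.of_bound hcont.aestronglyMeasurable (s 0) (.of_forall fun ζ => ?_)
    rw [Real.norm_of_nonneg (hnn ζ)]
    exact hs.antitone self_mem_Ici (torusDist_nonneg _ _ _) (torusDist_nonneg _ _ _)
  rw [setIntegral_pos_iff_support_of_nonneg_ae (.of_forall hnn) hint]
  have hsub : Ico c.1 (min L (c.1 + r / 2)) ×ˢ Ico c.2 (min L (c.2 + r / 2)) ⊆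
      Function.support (fun ζ : ℝ × ℝ => s (torusDist L ζ c)) ∩ square L := by
    rintro ζ ⟨h1, h2⟩
    rw [mem_Ico, lt_min_iff] at h1 h2
    obtain ⟨⟨hc1, hc2⟩, hc3, hc4⟩ := hc
    refine ⟨?_, mem_prod.2 ⟨⟨hc1.trans h1.1, h1.2.1⟩, ⟨hc3.trans h2.1, h2.2.1⟩⟩⟩
    rw [Function.mem_support]
    have h3 : torusDist L ζ c ≤ r := by
      refine (torusDist_le _ _ _).trans ?_
      rw [abs_of_nonneg (by linarith), abs_of_nonneg (by linarith)]
      linarith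
    exact (hsr.trans_le (hs.antitone (torusDist_nonneg _ _ _) hr.le h3)).ne'
  refine lt_of_lt_of_le ?_ (measure_mono hsub)
  rw [Measure.volume_eq_prod, Measure.prod_prod, Real.volume_Ico, Real.volume_Ico]
  have h4 : ∀ a, a < L → 0 < ENNReal.ofReal (min L (a + r / 2) - a) := fun a ha => by
    rw [ENNReal.ofReal_pos, sub_pos, lt_min_iff]
    exact ⟨ha, by linarith⟩
  exact ENNReal.mul_pos (h4 _ hc.1.2).ne' (h4 _ hc.2.2).ne'

lemma IsShape.shotKernel_nonneg {s : ℝ → ℝ} (hs : IsShape s) (L : ℝ) (c ξ : ℝ × ℝ) :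
    0 ≤ shotKernel s L c ξ :=
  div_nonneg (hs.nonneg _ (torusDist_nonneg _ _ _))
    (integral_nonneg fun _ => hs.nonneg _ (torusDist_nonneg _ _ _))

/-! ### Lower tail of a Poisson variable -/

/-- A Poisson variable of mean `t` is at most `t / 2` with probability at most `exp (-t / 8)`. -/
lemma IsPoissonProcess.measure_countIn_le {Ω : Type*} [MeasurableSpace Ω] {P : Measure Ω}
    {S : Ω → Finset ℕ} {x : ℕ → Ω → ℝ × ℝ} {μ : Measure (ℝ × ℝ)}
    (h : IsPoissonProcess P S x μ) {A : Set (ℝ × ℝ)} (hA : MeasurableSet A) {t : ℝ} (ht : 0 ≤ t)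
    (hμ : μ A = ENNReal.ofReal t) :
    P {ω | (countIn (S ω) (fun i => x i ω) A : ℝ) ≤ t / 2}
      ≤ ENNReal.ofReal (Real.exp (-(t / 8))) := by
  have := h.isProbabilityMeasure
  have hcm := measurable_countIn h.measurableSet_mem h.measurable_point hA
  -- Markov's inequality for the generating function at `1 / 2`, whose value is `exp (-t / 2)`
  let f : Ω → ℝ := fun ω => (1 / 2 : ℝ) ^ countIn (S ω) (fun i => x i ω) A
  have hf0 : ∀ ω, 0 ≤ f ω := fun ω => by positivity
  have hfm : Measurable f := (measurable_of_countable fun n : ℕ => (1 / 2 : ℝ) ^ n).comp hcm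
  have hfi : Integrable f P := Integrable.of_bound hfm.aestronglyMeasurable 1
    (.of_forall fun ω => by
      rw [Real.norm_of_nonneg (hf0 ω)]
      exact pow_le_one₀ (by norm_num) (by norm_num))
  have hf : ∫ ω, f ω ∂P = Real.exp (-(t / 2)) := by
    have h1 := h.integral_prod_pow (k := 1) (A := fun _ => A) (fun _ => hA)
      (fun a b hab => absurd (Subsingleton.elim a b) hab) (fun _ => ((1 / 2 : ℝ) : ℂ))
    simp only [Finset.univ_unique, Finset.prod_singleton, Finset.sum_singleton, hμ,
      ENNReal.toReal_ofReal ht] at h1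
    have h2 : ∫ ω, ((f ω : ℝ) : ℂ) ∂P = ((Real.exp (-(t / 2)) : ℝ) : ℂ) := by
      simp only [f]
      push_cast at h1 ⊢
      rw [h1]
      congr 1
      ring
    rw [integral_complex_ofReal] at h2
    exact_mod_cast h2
  have hM := mul_meas_ge_le_integral_of_nonneg (.of_forall hf0) hfi
    (Real.exp (-(Real.log 2 * (t / 2))))
  have hsub : {ω | (countIn (S ω) (fun i => x i ω) A : ℝ) ≤ t / 2} ⊆
      {ω | Real.exp (-(Real.log 2 * (t / 2))) ≤ f ω} := by
    intro ω hω
    have h1 : f ω = Real.exp (-(Real.log 2 * countIn (S ω) (fun i => x i ω) A)) := by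
      simp only [f]
      rw [one_div, inv_pow, Real.exp_neg, Real.exp_mul, Real.exp_log (by norm_num),
        Real.rpow_natCast]
    rw [mem_ofPred_eq, h1, Real.exp_le_exp, neg_le_neg_iff]
    exact mul_le_mul_of_nonneg_left hω (Real.log_nonneg (by norm_num))
  refine (measure_mono hsub).trans ?_
  rw [← ofReal_measureReal]
  refine ENNReal.ofReal_le_ofReal ?_
  rw [hf, ← le_div_iff₀' (Real.exp_pos _), ← Real.exp_sub] at hM
  refine hM.trans (Real.exp_le_exp.2 ?_)
  nlinarith [Real.log_two_lt_d9]

/-! ### Partition of the network area into cells -/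

/-- The cell with index `k` when the square of edge `K * l` is divided into `K ^ 2` cells of
edge `l`. -/
def cell (l : ℝ) (k : ℕ × ℕ) : Set (ℝ × ℝ) :=
  Ico (k.1 * l) ((k.1 + 1) * l) ×ˢ Ico (k.2 * l) ((k.2 + 1) * l)

lemma measurableSet_cell (l : ℝ) (k : ℕ × ℕ) : MeasurableSet (cell l k) :=
  measurableSet_Ico.prod measurableSet_Ico

lemma volume_cell (l : ℝ) (k : ℕ × ℕ) :
    volume (cell l k) = ENNReal.ofReal l * ENNReal.ofReal l := by
  have h : ∀ a : ℝ, (a + 1) * l - a * l = l := fun a => by ring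
  rw [cell, Measure.volume_eq_prod, Measure.prod_prod, Real.volume_Ico, Real.volume_Ico, h, h]

lemma cell_subset_square {L : ℝ} (hL : 0 < L) {K : ℕ} {k : ℕ × ℕ}
    (hk : k ∈ Finset.range K ×ˢ Finset.range K) : cell (L / K) k ⊆ square L := by
  obtain ⟨h1, h2⟩ := Finset.mem_product.1 hk
  rw [Finset.mem_range] at h1 h2
  have hK : (0 : ℝ) < K := by exact_mod_cast (Nat.zero_le _).trans_lt h1
  have hsub : ∀ a : ℕ, a < K → Ico (a * (L / K)) ((a + 1) * (L / K)) ⊆ Ico 0 L := by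
    intro a ha
    refine Ico_subset_Ico (by positivity) ?_
    have : (a : ℝ) + 1 ≤ K := by exact_mod_cast ha
    calc ((a : ℝ) + 1) * (L / K) ≤ K * (L / K) := by gcongr
      _ = L := by field_simp
  exact prod_mono (hsub _ h1) (hsub _ h2)

lemma exists_mem_cell {L : ℝ} (hL : 0 < L) {K : ℕ} (hK : 0 < K) {ξ : ℝ × ℝ} (hξ : ξ ∈ square L) :
    ∃ k ∈ Finset.range K ×ˢ Finset.range K, ξ ∈ cell (L / K) k := by
  have hK' : (0 : ℝ) < K := by exact_mod_cast hK
  have hl : 0 < L / K := by positivity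
  have h : ∀ x ∈ Ico 0 L, ∃ a ∈ Finset.range K, x ∈ Ico (a * (L / K)) ((a + 1) * (L / K)) := by
    intro x hx
    have hx0 : 0 ≤ x / (L / K) := div_nonneg hx.1 hl.le
    refine ⟨⌊x / (L / K)⌋₊, ?_, ?_, ?_⟩
    · rw [Finset.mem_range, Nat.floor_lt hx0, div_lt_iff₀ hl]
      calc x < L := hx.2
        _ = K * (L / K) := by field_simp
    · rw [← le_div_iff₀ hl]
      exact Nat.floor_le hx0
    · rw [← div_lt_iff₀ hl]
      exact Nat.lt_floor_add_one _
  obtain ⟨a, ha, hxa⟩ := h ξ.1 hξ.1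
  obtain ⟨b, hb, hxb⟩ := h ξ.2 hξ.2
  exact ⟨(a, b), Finset.mk_mem_product ha hb, hxa, hxb⟩

lemma torusDist_le_of_mem_cell (L : ℝ) {l : ℝ} {k : ℕ × ℕ} {ξ ζ : ℝ × ℝ} (hξ : ξ ∈ cell l k)
    (hζ : ζ ∈ cell l k) : torusDist L ξ ζ ≤ 2 * l := by
  have h : ∀ {a x y : ℝ}, x ∈ Ico (a * l) ((a + 1) * l) → y ∈ Ico (a * l) ((a + 1) * l) →
      |x - y| ≤ l := by
    intro a x y hx hy
    rw [abs_le]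
    constructor <;> linarith [hx.1, hx.2, hy.1, hy.2]
  linarith [torusDist_le L ξ ζ, h hξ.1 hζ.1, h hξ.2 hζ.2]

lemma homogeneousIntensity_cell {L m : ℝ} (hL : 0 < L) (hm : 0 ≤ m) {K : ℕ} {k : ℕ × ℕ}
    (hk : k ∈ Finset.range K ×ˢ Finset.range K) :
    homogeneousIntensity L (m / L ^ 2) (cell (L / K) k) = ENNReal.ofReal (m / K ^ 2) := by
  rw [homogeneousIntensity, Measure.smul_apply, smul_eq_mul,
    Measure.restrict_apply (measurableSet_cell _ _),
    inter_eq_self_of_subset_left (cell_subset_square hL hk), volume_cell,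
    ← ENNReal.ofReal_mul (by positivity), ← ENNReal.ofReal_mul (by positivity)]
  congr 1
  have hL' := hL.ne'
  field_simp

/-- The shots of the centres in a cell dominate the local intensity on the cell. -/
lemma IsShape.countIn_mul_le_localIntensity {s : ℝ → ℝ} (hs : IsShape s) {C : ℝ} {γ ν n : ℝ}
    (hn : 0 < n)
    (hC : ∀ c ∈ square (edge γ n), ∫ ζ in square (edge γ n), s (torusDist (edge γ n) ζ c) ≤ C)
    {K : ℕ} {k : ℕ × ℕ} (hk : k ∈ Finset.range K ×ˢ Finset.range K) (M : ℕ) (c : ℕ → ℝ × ℝ)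
    {ξ : ℝ × ℝ} (hξ : ξ ∈ cell (edge γ n / K) k) :
    countIn (Finset.range M) c (cell (edge γ n / K) k) *
        (perCluster ν n * (s (2 * (edge γ n / K)) / C)) ≤ localIntensity γ ν s n M c ξ := by
  classical
  have hL : 0 < edge γ n := Real.rpow_pos_of_pos hn _
  have hq : 0 < perCluster ν n := Real.rpow_pos_of_pos hn _
  rw [countIn, ← nsmul_eq_mul, localIntensity]
  refine le_trans ?_ (Finset.sum_le_sum_of_subset_of_nonneg (Finset.filter_subset
    (fun i => c i ∈ cell (edge γ n / K) k) _)
    fun j _ _ => mul_nonneg hq.le (hs.shotKernel_nonneg _ _ _))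
  refine Finset.card_nsmul_le_sum _ _ _ fun j hj => ?_
  have hj := (Finset.mem_filter.1 hj).2
  have hsq := cell_subset_square hL hk hj
  have hd := torusDist_le_of_mem_cell (edge γ n) hξ hj
  have h0 := torusDist_nonneg (edge γ n) ξ (c j)
  refine mul_le_mul_of_nonneg_left ?_ hq.le
  exact div_le_div₀ (hs.nonneg _ h0) (hs.antitone h0 (h0.trans hd) hd) (hs.integral_pos hsq)
    (hC _ hsq)

/-- If the network area is divided into `K ^ 2` cells, then with probability at least
`1 - K ^ 2 exp (- m / (8 K ^ 2))` each cell has at least half of its expected number `m / K ^ 2` of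
centres, whence a lower bound for the local intensity. -/
theorem IsShape.measure_localIntensity_lt_le {s : ℝ → ℝ} (hs : IsShape s) {C : ℝ} (hC0 : 0 < C)
    {γ ν n : ℝ} (hn : 0 < n)
    (hC : ∀ c ∈ square (edge γ n), ∫ ζ in square (edge γ n), s (torusDist (edge γ n) ζ c) ≤ C)
    {K : ℕ} (hK : 0 < K) {Ω : Type*} [MeasurableSpace Ω] {P : Measure Ω} {M : Ω → ℕ}
    {c : ℕ → Ω → ℝ × ℝ} (h : IsCentreProcess γ ν n P M c) :
    P {ω | ¬ ∀ ξ ∈ square (edge γ n), clusters ν n / K ^ 2 / 2 *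
        (perCluster ν n * (s (2 * (edge γ n / K)) / C)) ≤
          localIntensity γ ν s n (M ω) (fun j => c j ω) ξ}
      ≤ ENNReal.ofReal (K ^ 2 * Real.exp (-(clusters ν n / K ^ 2 / 8))) := by
  have hL : 0 < edge γ n := Real.rpow_pos_of_pos hn _
  have hq : 0 < perCluster ν n := Real.rpow_pos_of_pos hn _
  have hm : 0 < clusters ν n := Real.rpow_pos_of_pos hn _
  let t := clusters ν n / K ^ 2
  let bad : ℕ × ℕ → Set Ω := fun k => {ω | (countIn (Finset.range (M ω)) (fun j => c j ω)
    (cell (edge γ n / K) k) : ℝ) ≤ t / 2}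
  have hsub : {ω | ¬ ∀ ξ ∈ square (edge γ n), clusters ν n / K ^ 2 / 2 *
        (perCluster ν n * (s (2 * (edge γ n / K)) / C)) ≤
          localIntensity γ ν s n (M ω) (fun j => c j ω) ξ} ⊆
      ⋃ k ∈ Finset.range K ×ˢ Finset.range K, bad k := by
    intro ω hω
    by_contra hgood
    refine hω fun ξ hξ => ?_
    obtain ⟨k, hk, hξk⟩ := exists_mem_cell hL hK hξ
    have h1 : t / 2 < countIn (Finset.range (M ω)) (fun j => c j ω) (cell (edge γ n / K) k) := by
      by_contra hle
      exact hgood (mem_iUnion₂.2 ⟨k, hk, not_lt.1 hle⟩)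
    refine le_trans ?_ (hs.countIn_mul_le_localIntensity hn hC hk (M ω) (fun j => c j ω) hξk)
    refine mul_le_mul_of_nonneg_right h1.le ?_
    have := hs.nonneg (2 * (edge γ n / K)) (by positivity)
    positivity
  calc _ ≤ P (⋃ k ∈ Finset.range K ×ˢ Finset.range K, bad k) := measure_mono hsub
    _ ≤ ∑ k ∈ Finset.range K ×ˢ Finset.range K, P (bad k) := measure_biUnion_finset_le _ _
    _ ≤ ∑ k ∈ Finset.range K ×ˢ Finset.range K, ENNReal.ofReal (Real.exp (-(t / 8))) :=
        Finset.sum_le_sum fun k hk => IsPoissonProcess.measure_countIn_le h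
          (measurableSet_cell _ _) (by positivity) (homogeneousIntensity_cell hL hm.le hk)
    _ = _ := by
        rw [Finset.sum_const, Finset.card_product, Finset.card_range, nsmul_eq_mul,
          ENNReal.ofReal_mul (by positivity), ← Nat.cast_pow, ENNReal.ofReal_natCast, ← sq]
        simp only [t, Nat.cast_pow]

/-! ### Lower bounds of the local intensity in the two regimes -/

/-- Sufficient condition for a level to be exceeded with high probability: a division into
`K n ^ 2` cells for which the union bound is `O (1 / n)`. -/
lemma IsShape.intensityAboveWhp {s : ℝ → ℝ} (hs : IsShape s) {C : ℝ} (hC0 : 0 < C)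
    (hC : ∀ L : ℝ, 0 < L → ∀ c ∈ square L, ∫ ζ in square L, s (torusDist L ζ c) ≤ C)
    {γ ν : ℝ} {Φ₀ : ℝ → ℝ} (K : ℝ → ℕ)
    (h : ∀ᶠ n in atTop, 0 < K n ∧
      (K n : ℝ) ^ 2 * Real.exp (-(clusters ν n / K n ^ 2 / 8)) ≤ 1 / n ∧
      Φ₀ n < clusters ν n / K n ^ 2 / 2 * (perCluster ν n * (s (2 * (edge γ n / K n)) / C))) :
    IntensityAboveWhp.{u} γ ν s Φ₀ := by
  refine ⟨1, ?_⟩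
  filter_upwards [h, eventually_gt_atTop 0] with n ⟨hK, hexp, hlt⟩ hn Ω _ P M c hc
  refine le_trans (measure_mono ?_) ((hs.measure_localIntensity_lt_le hC0 hn
    (hC _ (Real.rpow_pos_of_pos hn _)) hK hc).trans (ENNReal.ofReal_le_ofReal hexp))
  intro ω hω hall
  exact hω fun ξ hξ => hlt.trans_le (hall ξ hξ)

/-- In the cluster-dense regime the cells have a fixed edge `r / 2` (up to rounding), and the number
of centres per cell grows like a power of `n`. -/
theorem IsShape.exists_intensityAboveWhp_denseLevel {s : ℝ → ℝ} (hs : IsShape s) {γ ν : ℝ}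
    (hγ : 0 ≤ γ) (hd : γ < ν / 2) :
    ∃ g : ℝ, 0 < g ∧ IntensityAboveWhp.{u} γ ν s (denseLevel γ g) := by
  obtain ⟨C, hC0, hC⟩ := hs.exists_integral_le
  obtain ⟨r, hr, hsr⟩ := hs.exists_pos
  let B := 2 / r + 1
  have hB : 0 < B := by positivity
  have hβ : 0 < ν - 2 * γ := by linarith
  refine ⟨s r / (4 * C * B ^ 2), by positivity,
    hs.intensityAboveWhp hC0 hC (fun n => ⌈2 * edge γ n / r⌉₊) ?_⟩
  have hlim : Tendsto (fun n : ℝ => (n ^ (ν - 2 * γ)) ^ ((2 * γ + 1) / (ν - 2 * γ)) *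
      Real.exp (-(1 / (8 * B ^ 2)) * n ^ (ν - 2 * γ))) atTop (nhds 0) :=
    (tendsto_rpow_mul_exp_neg_mul_atTop_nhds_zero _ _ (by positivity)).comp (tendsto_rpow_atTop hβ)
  filter_upwards [eventually_ge_atTop 1,
    hlim.eventually (ge_mem_nhds (show (0 : ℝ) < 1 / B ^ 2 by positivity))] with n hn1 hn2
  have hn : 0 < n := by linarith
  have hL : 1 ≤ edge γ n := Real.one_le_rpow hn1 hγ
  have hL0 : 0 < edge γ n := by linarith
  have hq : 0 < perCluster ν n := Real.rpow_pos_of_pos hn _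
  have hm : 0 < clusters ν n := Real.rpow_pos_of_pos hn _
  set K : ℕ := ⌈2 * edge γ n / r⌉₊
  have hK1 : 2 * edge γ n / r ≤ K := Nat.le_ceil _
  have hK0 : (0 : ℝ) < K := lt_of_lt_of_le (by positivity) hK1
  have hK2 : (K : ℝ) ≤ B * edge γ n := by
    have := (Nat.ceil_lt_add_one (show 0 ≤ 2 * edge γ n / r by positivity)).le
    calc (K : ℝ) ≤ 2 * edge γ n / r + 1 := this
      _ ≤ 2 * edge γ n / r + edge γ n := by linarith
      _ = B * edge γ n := by simp only [B]; ring
  have hK3 : (K : ℝ) ^ 2 ≤ B ^ 2 * edge γ n ^ 2 := by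
    rw [← mul_pow]; exact pow_le_pow_left₀ hK0.le hK2 2
  have hLsq : edge γ n ^ 2 = n ^ (2 * γ) := by
    rw [edge, ← Real.rpow_natCast, ← Real.rpow_mul hn.le, mul_comm γ]; norm_num
  have hmL : clusters ν n / edge γ n ^ 2 = n ^ (ν - 2 * γ) := by
    rw [hLsq, clusters, ← Real.rpow_sub hn]
  have ht : clusters ν n / edge γ n ^ 2 / B ^ 2 ≤ clusters ν n / K ^ 2 := by
    rw [div_div]
    exact div_le_div_of_nonneg_left hm.le (by positivity) (by linarith)
  refine ⟨by exact_mod_cast hK0, ?_, ?_⟩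
  · rw [← Real.rpow_mul hn.le, mul_div_cancel₀ _ hβ.ne', Real.rpow_add hn, Real.rpow_one,
      ← hLsq, ← hmL] at hn2
    have h1 : Real.exp (-(clusters ν n / K ^ 2 / 8)) ≤
        Real.exp (-(1 / (8 * B ^ 2)) * (clusters ν n / edge γ n ^ 2)) := by
      rw [Real.exp_le_exp]
      have : -(1 / (8 * B ^ 2)) * (clusters ν n / edge γ n ^ 2)
        = -(clusters ν n / edge γ n ^ 2 / B ^ 2 / 8) := by field_simp
      rw [this]
      linarith
    rw [le_div_iff₀ hn]
    set E := Real.exp (-(1 / (8 * B ^ 2)) * (clusters ν n / edge γ n ^ 2))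
    calc (K : ℝ) ^ 2 * Real.exp (-(clusters ν n / K ^ 2 / 8)) * n
        ≤ (B ^ 2 * edge γ n ^ 2) * E * n := by gcongr
      _ = B ^ 2 * (edge γ n ^ 2 * n * E) := by ring
      _ ≤ B ^ 2 * (1 / B ^ 2) := by gcongr
      _ = 1 := by field_simp
  · have hmq : clusters ν n * perCluster ν n = n := by
      rw [clusters, perCluster, ← Real.rpow_add hn]; simp
    have hs2 : s r ≤ s (2 * (edge γ n / K)) := by
      refine hs.antitone (mem_Ici.2 (by positivity)) hr.le ?_
      rw [← mul_div_assoc, div_le_iff₀ hK0, ← div_le_iff₀' hr]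
      exact hK1
    calc denseLevel γ (s r / (4 * C * B ^ 2)) n
        = (n / edge γ n ^ 2 / B ^ 2 / 2 * (s r / C)) / 2 := by
          rw [denseLevel]; field_simp; norm_num
      _ < n / edge γ n ^ 2 / B ^ 2 / 2 * (s r / C) := half_lt_self (by positivity)
      _ = clusters ν n / edge γ n ^ 2 / B ^ 2 / 2 * (perCluster ν n * (s r / C)) := by
          nth_rewrite 1 [← hmq]; ring
      _ ≤ _ := by gcongr

/-- A shape with a power-law tail is positive and changes by a bounded factor under dilations. -/
lemma exists_mul_le_comp_mul {s : ℝ → ℝ} (hs : IsShape s) {δ : ℝ}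
    (hδ : s =Θ[atTop] fun r : ℝ => r ^ (-δ)) {B : ℝ} (hB : 0 < B) :
    ∃ a : ℝ, 0 < a ∧ ∀ᶠ r in atTop, 0 < s r ∧ a * s r ≤ s (B * r) := by
  obtain ⟨c₁, hc₁, h₁⟩ := hδ.1.exists_pos
  obtain ⟨c₂, hc₂, h₂⟩ := hδ.2.exists_pos
  refine ⟨B ^ (-δ) / (c₁ * c₂), by positivity, ?_⟩
  filter_upwards [h₁.bound, h₂.bound, (tendsto_id.const_mul_atTop hB).eventually h₂.bound,
    eventually_gt_atTop 0] with r hr₁ hr₂ hr₃ hr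
  have hp : 0 < r ^ (-δ) := Real.rpow_pos_of_pos hr _
  have hBp : 0 < B ^ (-δ) := Real.rpow_pos_of_pos hB _
  rw [Real.norm_of_nonneg (hs.nonneg _ hr.le), Real.norm_of_nonneg hp.le] at hr₁ hr₂
  rw [id, Real.norm_of_nonneg (hs.nonneg _ (by positivity)),
    Real.norm_of_nonneg (by positivity), Real.mul_rpow hB.le hr.le] at hr₃
  refine ⟨pos_of_mul_pos_right (hp.trans_le hr₂) hc₂.le, ?_⟩
  rw [div_mul_eq_mul_div, div_le_iff₀ (by positivity)]
  calc B ^ (-δ) * s r ≤ B ^ (-δ) * (c₁ * r ^ (-δ)) := by gcongr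
    _ = c₁ * (B ^ (-δ) * r ^ (-δ)) := by ring
    _ ≤ c₁ * (c₂ * s (B * r)) := by gcongr
    _ = _ := by ring

/-- In the cluster-sparse regime the edge of the cells is of the order of
`typicalDist γ ν n * √(log m)`, and the expected number of centres per cell is at least
`A * log m`; the constant `A = 8 * (1 + 1 / ν)` makes the union bound
`m * m ^ (- A / 8) = 1 / n`. -/
theorem IsShape.exists_intensityAboveWhp_sparseLevel {s : ℝ → ℝ} (hs : IsShape s) {γ ν : ℝ}
    (hν : 0 < ν) (hd : ν / 2 < γ) {δ : ℝ} (hδ : s =Θ[atTop] fun r : ℝ => r ^ (-δ)) :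
    ∃ g : ℝ, 0 < g ∧ IntensityAboveWhp.{u} γ ν s (sparseLevel γ ν s g) := by
  obtain ⟨C, hC0, hC⟩ := hs.exists_integral_le
  let A := 8 * (1 + 1 / ν)
  have hA : 0 < A := by positivity
  obtain ⟨a, ha, hsa⟩ := exists_mul_le_comp_mul hs hδ (B := 4 * √A) (by positivity)
  let ℓ : ℝ → ℝ := fun n => Real.log (clusters ν n)
  let X : ℝ → ℝ := fun n => √(clusters ν n / (A * ℓ n))
  refine ⟨a * A / (4 * C), by positivity, hs.intensityAboveWhp hC0 hC (fun n => ⌊X n⌋₊) ?_⟩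
  have hm_lim : Tendsto (clusters ν) atTop atTop := tendsto_rpow_atTop hν
  have hℓ_lim : Tendsto ℓ atTop atTop := Real.tendsto_log_atTop.comp hm_lim
  have hX1 : ∀ᶠ n in atTop, A * ℓ n ≤ clusters ν n := by
    have h := hm_lim.eventually
      ((Real.isLittleO_log_id_atTop.bound (show (0 : ℝ) < 1 / A by positivity)))
    filter_upwards [h, hm_lim.eventually_gt_atTop 0, hℓ_lim.eventually_ge_atTop 0] with n h1 h2 h3
    rw [Real.norm_of_nonneg h3, id, Real.norm_of_nonneg h2.le] at h1
    rwa [← le_div_iff₀' hA, div_eq_inv_mul, ← one_div]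
  have hD_lim : Tendsto (fun n => typicalDist γ ν n * √(ℓ n)) atTop atTop := by
    refine tendsto_atTop_mono' _ ?_ (tendsto_rpow_atTop (show 0 < γ - ν / 2 by linarith))
    filter_upwards [eventually_gt_atTop 0, hℓ_lim.eventually_ge_atTop 1] with n hn hℓ
    have h1 : typicalDist γ ν n = n ^ (γ - ν / 2) := by
      rw [typicalDist, edge, clusters, Real.sqrt_eq_rpow, ← Real.rpow_mul hn.le,
        ← Real.rpow_sub hn]
      congr 1; ring
    rw [h1]
    exact le_mul_of_one_le_right (by positivity) (Real.one_le_sqrt.2 hℓ)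
  filter_upwards [eventually_gt_atTop 0, hX1, hℓ_lim.eventually_ge_atTop 1,
    hD_lim.eventually hsa] with n hn hX hℓ ⟨hsD, hsaD⟩
  have hL : 0 < edge γ n := Real.rpow_pos_of_pos hn _
  have hq : 0 < perCluster ν n := Real.rpow_pos_of_pos hn _
  have hm : 0 < clusters ν n := Real.rpow_pos_of_pos hn _
  have hℓ0 : 0 < ℓ n := by linarith
  have hA8 : 8 ≤ A := by
    have : 0 < 1 / ν := by positivity
    simp only [A]; linarith
  set K : ℕ := ⌊X n⌋₊
  have hX1 : 1 ≤ X n := Real.one_le_sqrt.2 ((one_le_div (by positivity)).2 hX)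
  have hX0 : 0 < X n := by linarith
  have hK1 : (1 : ℝ) ≤ K := by exact_mod_cast (Nat.one_le_floor_iff _).2 hX1
  have hK0 : (0 : ℝ) < K := by linarith
  have hKX : (K : ℝ) ≤ X n := Nat.floor_le hX0.le
  have hXK : X n ≤ 2 * K := by
    have := (Nat.lt_floor_add_one (X n)).le
    linarith
  have hXsq : X n ^ 2 = clusters ν n / (A * ℓ n) := Real.sq_sqrt (by positivity)
  have hKsq : (K : ℝ) ^ 2 ≤ clusters ν n / (A * ℓ n) :=
    hXsq ▸ pow_le_pow_left₀ hK0.le hKX 2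
  have ht : A * ℓ n ≤ clusters ν n / K ^ 2 := by
    rw [le_div_iff₀ (by positivity), mul_comm, ← le_div_iff₀ (by positivity)]
    exact hKsq
  refine ⟨by exact_mod_cast hK0, ?_, ?_⟩
  · have h1 : (K : ℝ) ^ 2 ≤ clusters ν n := by
      refine hKsq.trans (div_le_self hm.le ?_)
      nlinarith
    calc (K : ℝ) ^ 2 * Real.exp (-(clusters ν n / K ^ 2 / 8))
        ≤ clusters ν n * Real.exp (-(A * ℓ n / 8)) := by gcongr
      _ = Real.exp (ℓ n) * Real.exp (-(A * ℓ n / 8)) := by rw [Real.exp_log hm]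
      _ = Real.exp (-Real.log n) := by
          rw [← Real.exp_add]
          congr 1
          simp only [ℓ, A, clusters, Real.log_rpow hn]
          field_simp
          ring
      _ = 1 / n := by rw [Real.exp_neg, Real.exp_log hn, one_div]
  · set D := typicalDist γ ν n * √(ℓ n)
    have hD : 2 * (edge γ n / K) ≤ 4 * √A * D := by
      have h2 : edge γ n / K ≤ 2 * (edge γ n / X n) := by
        rw [← mul_div_assoc, div_le_div_iff₀ hK0 hX0]
        nlinarith
      have h3 : edge γ n / X n = √A * D := by
        simp only [X, D, typicalDist]
        rw [Real.sqrt_div hm.le, Real.sqrt_mul hA.le]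
        have := Real.sqrt_pos.2 hm
        field_simp
      linarith
    have hs2 : a * s D ≤ s (2 * (edge γ n / K)) :=
      hsaD.trans (hs.antitone (mem_Ici.2 (by positivity))
        (mem_Ici.2 (le_trans (by positivity) hD)) hD)
    calc sparseLevel γ ν s (a * A / (4 * C)) n
        = (A * ℓ n / 2 * (perCluster ν n * (a * s D / C))) / 2 := by
          simp only [sparseLevel, D, ℓ]; ring
      _ < A * ℓ n / 2 * (perCluster ν n * (a * s D / C)) := half_lt_self (by positivity)
      _ ≤ _ := by gcongr

end SNCP

theorem lemma2 (γ ν : ℝ) (hγ : 0 ≤ γ) (hν₀ : 0 < ν) (hν₁ : ν < 1)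
    (s : ℝ → ℝ) (hs : SNCP.IsShape s) :
    (γ < ν / 2 →
      (∃ g₁ : ℝ, 0 < g₁ ∧ SNCP.IntensityAboveWhp.{u} γ ν s (SNCP.denseLevel γ g₁)) ∧
      ∀ g₁ : ℝ, 0 < g₁ → SNCP.IntensityAboveWhp.{u} γ ν s (SNCP.denseLevel γ g₁) →
        SNCP.ExtractsHomogeneousWhp.{u, v} γ ν s (SNCP.denseLevel γ g₁)) ∧
    (ν / 2 < γ →
      ((∃ δ : ℝ, 2 < δ ∧ s =Θ[atTop] (fun r : ℝ => r ^ (-δ))) →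
        ∃ g₂ : ℝ, 0 < g₂ ∧ SNCP.IntensityAboveWhp.{u} γ ν s (SNCP.sparseLevel γ ν s g₂)) ∧
      ∀ g₂ : ℝ, 0 < g₂ → SNCP.IntensityAboveWhp.{u} γ ν s (SNCP.sparseLevel γ ν s g₂) →
        SNCP.ExtractsHomogeneousWhp.{u, v} γ ν s (SNCP.sparseLevel γ ν s g₂)) := by
  refine ⟨fun hd => ⟨hs.exists_intensityAboveWhp_denseLevel hγ hd,
    fun _ _ h => h.extractsHomogeneousWhp hs⟩, fun hd => ⟨?_,
    fun _ _ h => h.extractsHomogeneousWhp hs⟩⟩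
  rintro ⟨δ, -, hδ⟩
  exact hs.exists_intensityAboveWhp_sparseLevel hν₀ hd hδ
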